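/- Let $k$ be a field of characteristic $p>0$, let $G$ be a finite group with $p\mid |G|$, and let $P$ be a Sylow $p$-subgroup of $G$. For a finite group $H$ let $T_k(H)$ be the Picard group of the stable category of finite-dimensional $kH$-modules (isomorphism classes of $\otimes_k$-invertible objects). Let $T_k(G,P)$ and $I_k(G,P)$ be the kernel and the image of the restriction $T_k(G)\to T_k(P)$. Let $\mathcal O(G)$ be the category of the $G$-sets $G/H$ ($H\le G$) and $G$-maps, and $\mathcal O_p^\circ(G)$ its full subcategory on the $G/R$ with $R$ a non-trivial $p$-subgroup. For $\mathcal C$ either category, $\mathbb Z\mathcal C$-modules are presheaves of abelian groups on $\mathcal C$, and $\underline{\mathbb Z}$ is the constant one. Let $\mathrm{Pic}$ be the presheaf $G/H\mapsto T_k(H)$ on $\mathcal O(G)$ (a map $G/H\to G/K$, $xH\mapsto xgK$, acts by restriction along $H\to K$, $h\mapsto g^{-1}hg$), and also its restriction to $\mathcal O_p^\circ(G)$. Call a sieve $S$ on $G/H$ covering if every $u\in G/H$ has a preimage $v$ under some map in $S$ with $[\mathrm{Stab}_G(u):\mathrm{Stab}_G(v)]$ prime to $p$; let $S^{\min}_{G/G}$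 be the intersection of all covering sieves on $G/G$, $\mathbb ZS^{\min}_{G/G}$ the free abelian presheaf on it, and $\mathfrak Q$ the cokernel of the canonical monomorphism $\mathbb ZS^{\min}_{G/G}\to\underline{\mathbb Z}$. Then: (1) There is an isomorphism of groups $T_k(G,P)\cong \mathrm{Hom}_{\mathbb Z\mathcal O(G)}(\mathfrak Q,\mathrm{Pic})$, under which $x\in T_k(G,P)$ corresponds to the morphism $\mathfrak Q\to\mathrm{Pic}$ whose value at $G/G$ sends the class of $1\in\mathbb Z$ to $x\in T_k(G)=\mathrm{Pic}(G/G)$. (2) Restriction to $\mathcal O_p^\circ(G)$, where $\mathbb ZS^{\min}_{G/G}$ becomes $\underline{\mathbb Z}$, is an isomorphism $\mathrm{Hom}_{\mathbb Z\mathcal O(G)}(\mathbb ZS^{\min}_{G/G},\mathrm{Pic})\cong \mathrm{Hom}_{\mathbb Z\mathcal O_p^\circ(G)}(\underline{\mathbb Z},\mathrm{Pic})$; the evaluation $\theta\mapsto\theta_{G/P}(1)$ is an injective homomorphism $\mathrm{Hom}_{\mathbb Z\mathcal O_p^\circ(G)}(\underline{\mathbb Z},\mathrm{Pic})\to T_k(P)$;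 and it restricts to an isomorphism $$\ker\bigl(\mathrm{Hom}_{\mathbb Z\mathcal O_p^\circ(G)}(\underline{\mathbb Z},\mathrm{Pic})\to \mathrm{Ext}^1_{\mathbb Z\mathcal O(G)}(\mathfrak Q,\mathrm{Pic})\bigr)\;\cong\; I_k(G,P),$$ where the map is the connecting homomorphism of $0\to\mathbb ZS^{\min}_{G/G}\to\underline{\mathbb Z}\to\mathfrak Q\to0$ precomposed with the inverse of the restriction isomorphism. -/

import Mathlib

open CategoryTheory Limits MonoidalCategory

universe u

namespace Endotrivial

section StableCategory

variable {k : Type u} [Field k] {G : Type u} [Group G]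

/-- A map of finite-dimensional `kG`-modules that factors through a (finite-dimensional) projective
`kG`-module. -/
def FactorsThroughProjective {X Y : FDRep k G} (f : X ⟶ Y) : Prop :=
  ∃ Z : FDRep k G, Projective Z ∧ ∃ (a : X ⟶ Z) (b : Z ⟶ Y), a ≫ b = f

variable (k G) in
/-- Two `kG`-maps are stably equal when their difference factors through a projective module. -/
def stableRel : HomRel (FDRep k G) :=
  fun _ _ f g => FactorsThroughProjective (f - g)

lemma FactorsThroughProjective.comp_left {X Y Z : FDRep k G} (f : X ⟶ Y) {g : Y ⟶ Z}
    (h : FactorsThroughProjective g) : FactorsThroughProjective (f ≫ g) := by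
  obtain ⟨W, hW, a, b, rfl⟩ := h
  exact ⟨W, hW, f ≫ a, b, by simp⟩

lemma FactorsThroughProjective.comp_right {X Y Z : FDRep k G} {f : X ⟶ Y} (g : Y ⟶ Z)
    (h : FactorsThroughProjective f) : FactorsThroughProjective (f ≫ g) := by
  obtain ⟨W, hW, a, b, rfl⟩ := h
  exact ⟨W, hW, a, b ≫ g, by simp⟩

lemma FactorsThroughProjective.zero (X Y : FDRep k G) :
    FactorsThroughProjective (0 : X ⟶ Y) := by
  have : HasZeroObject (FDRep k G) := hasZeroObject_of_hasTerminal_object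
  open ZeroObject in
  exact ⟨0, inferInstance, 0, 0, by simp⟩

lemma FactorsThroughProjective.neg {X Y : FDRep k G} {f : X ⟶ Y}
    (h : FactorsThroughProjective f) : FactorsThroughProjective (-f) := by
  obtain ⟨W, hW, a, b, rfl⟩ := h
  exact ⟨W, hW, -a, b, by simp⟩

lemma FactorsThroughProjective.add {X Y : FDRep k G} {f g : X ⟶ Y}
    (hf : FactorsThroughProjective f) (hg : FactorsThroughProjective g) :
    FactorsThroughProjective (f + g) := by
  obtain ⟨W, hW, a, b, rfl⟩ := hf
  obtain ⟨W', hW', a', b', rfl⟩ := hg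
  have : HasBinaryBiproducts (FDRep k G) := HasBinaryBiproducts.of_hasBinaryProducts
  exact ⟨W ⊞ W', inferInstance, biprod.lift a a', biprod.desc b b', by simp⟩

instance : Congruence (stableRel k G) where
  equivalence :=
    { refl := fun f => by
        simpa [stableRel] using FactorsThroughProjective.zero _ _
      symm := fun {f g} h => by
        simpa [stableRel] using FactorsThroughProjective.neg h
      trans := fun {f g h} h₁ h₂ => by
        simpa [stableRel] using FactorsThroughProjective.add h₁ h₂ }
  comp_left f _ _ h := by
    simpa [stableRel] using FactorsThroughProjective.comp_left f h
  comp_right g h := by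
    simpa [stableRel] using FactorsThroughProjective.comp_right g h

lemma projective_tensor_left (M : FDRep k G) {P : FDRep k G} (hP : Projective P) :
    Projective (M ⊗ P) := by
  let e₁ : ExactPairing Mᘁ M := BraidedCategory.exactPairing_swap M Mᘁ
  let e₂ : ExactPairing M Mᘁ := inferInstance
  have : (tensorLeft Mᘁ).IsLeftAdjoint := (tensorLeftAdjunction M Mᘁ).isLeftAdjoint
  exact Adjunction.map_projective (tensorLeftAdjunction Mᘁ M) P hP

lemma FactorsThroughProjective.whiskerLeft (M : FDRep k G) {X Y : FDRep k G} {f : X ⟶ Y}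
    (h : FactorsThroughProjective f) : FactorsThroughProjective (M ◁ f) := by
  obtain ⟨W, hW, a, b, rfl⟩ := h
  exact ⟨M ⊗ W, projective_tensor_left M hW, M ◁ a, M ◁ b, by simp⟩

lemma FactorsThroughProjective.whiskerRight {X Y : FDRep k G} {f : X ⟶ Y}
    (h : FactorsThroughProjective f) (M : FDRep k G) : FactorsThroughProjective (f ▷ M) := by
  have := ((h.whiskerLeft M).comp_left (β_ X M).hom).comp_right (β_ M Y).hom
  simpa using this

variable (k G) in
/-- The stable module category `kG-stmod`: finite-dimensional `kG`-modules, with `kG`-maps modulo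
those factoring through a projective module. -/
abbrev StMod : Type (u + 1) := Quotient (stableRel k G)

variable (k G) in
/-- The quotient functor from `kG`-modules to the stable module category. -/
abbrev toStMod : FDRep k G ⥤ StMod k G := Quotient.functor (stableRel k G)

lemma toStMod_map_eq_iff {X Y : FDRep k G} (f g : X ⟶ Y) :
    (toStMod k G).map f = (toStMod k G).map g ↔ FactorsThroughProjective (f - g) :=
  Quotient.functor_map_eq_iff _ _ _

/-- The tensor product `⊗_k` (with diagonal `G`-action) on the stable module category. -/
instance : MonoidalCategoryStruct (StMod k G) where
  tensorObj X Y := (toStMod k G).obj (X.as ⊗ Y.as)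
  tensorUnit := (toStMod k G).obj (𝟙_ (FDRep k G))
  whiskerLeft X {Y Z} f := Quot.lift (fun g : Y.as ⟶ Z.as => (toStMod k G).map (X.as ◁ g))
    (fun a b h => by
      rw [HomRel.compClosure_iff_self] at h
      rw [toStMod_map_eq_iff]
      exact (tensorLeft X.as).map_sub (f := a) (g := b) ▸
        FactorsThroughProjective.whiskerLeft X.as h) f
  whiskerRight {X Y} f Z := Quot.lift (fun g : X.as ⟶ Y.as => (toStMod k G).map (g ▷ Z.as))
    (fun a b h => by
      rw [HomRel.compClosure_iff_self] at h
      rw [toStMod_map_eq_iff]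
      exact (tensorRight Z.as).map_sub (f := a) (g := b) ▸
        FactorsThroughProjective.whiskerRight h Z.as) f
  associator X Y Z := (toStMod k G).mapIso (α_ X.as Y.as Z.as)
  leftUnitor X := (toStMod k G).mapIso (λ_ X.as)
  rightUnitor X := (toStMod k G).mapIso (ρ_ X.as)


lemma stMod_hom_ind {X Y : StMod k G} {p : (X ⟶ Y) → Prop}
    (h : ∀ f : X.as ⟶ Y.as, p ((toStMod k G).map f)) (f : X ⟶ Y) : p f :=
  Quot.ind h f

lemma toStMod_whiskerLeft (X : StMod k G) {Y Z : FDRep k G} (f : Y ⟶ Z) :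
    X ◁ (toStMod k G).map f = (toStMod k G).map (X.as ◁ f) := rfl

lemma toStMod_whiskerRight (X : StMod k G) {Y Z : FDRep k G} (f : Y ⟶ Z) :
    (toStMod k G).map f ▷ X = (toStMod k G).map (f ▷ X.as) := rfl

instance : MonoidalCategory (StMod k G) where
  tensorHom_def _ _ := rfl
  id_tensorHom_id X Y := by
    refine ((toStMod k G).map_comp (𝟙 X.as ▷ Y.as) (X.as ◁ 𝟙 Y.as)).symm.trans ?_
    simp; rfl
  tensorHom_comp_tensorHom {X₁ Y₁ Z₁ X₂ Y₂ Z₂} f₁ f₂ g₁ g₂ := by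
    induction f₁ using stMod_hom_ind with | _ f₁
    induction f₂ using stMod_hom_ind with | _ f₂
    induction g₁ using stMod_hom_ind with | _ g₁
    induction g₂ using stMod_hom_ind with | _ g₂
    refine congrArg (toStMod k G).map (?_ : (f₁ ▷ X₂.as ≫ Y₁.as ◁ f₂) ≫ (g₁ ▷ Y₂.as ≫ Z₁.as ◁ g₂) = (f₁ ≫ g₁) ▷ X₂.as ≫ Z₁.as ◁ (f₂ ≫ g₂))
    simp [whisker_exchange_assoc]
  whiskerLeft_id X Y := congrArg (toStMod k G).map (whiskerLeft_id X.as Y.as)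
  id_whiskerRight X Y := congrArg (toStMod k G).map (id_whiskerRight X.as Y.as)
  associator_naturality {X₁ X₂ X₃ Y₁ Y₂ Y₃} f₁ f₂ f₃ := by
    induction f₁ using stMod_hom_ind with | _ f₁
    induction f₂ using stMod_hom_ind with | _ f₂
    induction f₃ using stMod_hom_ind with | _ f₃
    refine congrArg (toStMod k G).map (?_ :
      ((f₁ ▷ X₂.as ≫ Y₁.as ◁ f₂) ▷ X₃.as ≫ (Y₁.as ⊗ Y₂.as) ◁ f₃) ≫ (α_ Y₁.as Y₂.as Y₃.as).hom =
      (α_ X₁.as X₂.as X₃.as).hom ≫ (f₁ ▷ (X₂.as ⊗ X₃.as) ≫ Y₁.as ◁ (f₂ ▷ X₃.as ≫ Y₂.as ◁ f₃)))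
    simp
  leftUnitor_naturality {X Y} f := by
    induction f using stMod_hom_ind with | _ f
    exact congrArg (toStMod k G).map (leftUnitor_naturality f)
  rightUnitor_naturality {X Y} f := by
    induction f using stMod_hom_ind with | _ f
    exact congrArg (toStMod k G).map (rightUnitor_naturality f)
  pentagon W X Y Z := congrArg (toStMod k G).map (pentagon W.as X.as Y.as Z.as)
  triangle X Y := congrArg (toStMod k G).map (triangle X.as Y.as)

instance : BraidedCategory (StMod k G) where
  braiding X Y := (toStMod k G).mapIso (β_ X.as Y.as)
  braiding_naturality_right X {Y Z} f := by
    induction f using stMod_hom_ind with | _ f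
    exact congrArg (toStMod k G).map (BraidedCategory.braiding_naturality_right X.as f)
  braiding_naturality_left {X Y} f Z := by
    induction f using stMod_hom_ind with | _ f
    exact congrArg (toStMod k G).map (BraidedCategory.braiding_naturality_left f Z.as)
  hexagon_forward X Y Z :=
    congrArg (toStMod k G).map (BraidedCategory.hexagon_forward X.as Y.as Z.as)
  hexagon_reverse X Y Z :=
    congrArg (toStMod k G).map (BraidedCategory.hexagon_reverse X.as Y.as Z.as)

instance : SymmetricCategory (StMod k G) where
  symmetry X Y := congrArg (toStMod k G).map (SymmetricCategory.symmetry X.as Y.as)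

variable (k G) in
/-- The group of endotrivial modules `T_k(G)`: the Picard group of the stable module category, i.e.
the group of isomorphism classes of its `⊗`-invertible objects. -/
abbrev Tk : Type (u + 1) := (Skeleton (StMod k G))ˣ

end StableCategory
section Restriction
variable {k : Type u} [Field k] {G : Type u} [Group G] {H : Type u} [Group H]

lemma FDRep.hom_comm {X Y : FDRep k G} (f : X ⟶ Y) (g : G) (x : X) :
    (f.hom.hom.hom : X →ₗ[k] Y) (X.ρ g x) = Y.ρ g ((f.hom.hom.hom : X →ₗ[k] Y) x) := by
  have := congrArg (fun t => (t.hom.hom : X →ₗ[k] Y) x) (f.comm g)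
  exact this

/-- A `G`-equivariant linear map, as a morphism of representations. -/
def FDRep.homMk {X Y : FDRep k G} (f : X →ₗ[k] Y)
    (h : ∀ g x, f (X.ρ g x) = Y.ρ g (f x)) : X ⟶ Y where
  hom := FGModuleCat.ofHom f
  comm g := by
    ext x
    exact h g x

lemma FDRep.surjective_of_epi {X Y : FDRep k G} (e : X ⟶ Y) [Epi e] :
    Function.Surjective (e.hom.hom.hom : X →ₗ[k] Y) := by
  have : Epi ((forget₂ (FDRep k G) (Rep k G)).map e) := inferInstance
  exact (Rep.epi_iff_surjective _).1 this

lemma FDRep.epi_of_surjective {X Y : FDRep k G} (e : X ⟶ Y)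
   (h : Function.Surjective (e.hom.hom.hom : X →ₗ[k] Y)) : Epi e := by
  have : Epi ((forget₂ (FDRep k G) (Rep k G)).map e) := (Rep.epi_iff_surjective _).2 h
  exact (forget₂ (FDRep k G) (Rep k G)).epi_of_epi_map this

/-- Functions `G → V` with translation action (the module induced from the trivial subgroup). -/
def coindRep (G : Type u) [Group G] (V : Type u) [AddCommGroup V] [Module k V] :
    Representation k G (G → V) where
  toFun g := LinearMap.funLeft k V (fun x => g⁻¹ * x)
  map_one' := by ext; simp
  map_mul' a b := by ext; simp [mul_assoc, LinearMap.funLeft]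

open Classical in
lemma projective_iff_trace [Fintype G] (P : FDRep k G) :
    Projective P ↔ ∃ θ : P →ₗ[k] P, ∀ x, ∑ g : G, P.ρ g (θ (P.ρ g⁻¹ x)) = x := by
  constructor
  · intro hP
    let R : FDRep k G := FDRep.of (coindRep (k := k) G P)
    let e : R ⟶ P := FDRep.homMk (X := R) (Y := P)
      (∑ x : G, (P.ρ x) ∘ₗ LinearMap.proj (R := k) (φ := fun _ : G => (P : Type u)) x) (by
        intro g f
        change (∑ x : G, (P.ρ x) ∘ₗ LinearMap.proj (R := k) (φ := fun _ : G => (P : Type u)) x) (fun x => f (g⁻¹ * x)) = _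
        simp only [LinearMap.sum_apply, LinearMap.comp_apply, LinearMap.proj_apply, map_sum]
        rw [← Equiv.sum_comp (Equiv.mulLeft g)]
        refine Finset.sum_congr rfl fun x _ => ?_
        simp
        rfl)
    have he : ∀ f : G → P, (e.hom.hom.hom : (G → P) →ₗ[k] P) f = ∑ x : G, P.ρ x (f x) := by
      intro f
      change (∑ x : G, (P.ρ x) ∘ₗ LinearMap.proj (R := k) (φ := fun _ : G => (P : Type u)) x) f = _
      simp
    have : Epi e := by
      apply FDRep.epi_of_surjective
      intro v
      refine ⟨(Pi.single 1 v : G → P), ?_⟩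
      refine (he _).trans ?_
      rw [Finset.sum_eq_single 1] <;> simp +contextual
    let s : P ⟶ R := Projective.factorThru (𝟙 P) e
    have hs : s ≫ e = 𝟙 P := Projective.factorThru_comp _ _
    let s' : P →ₗ[k] (G → P) := s.hom.hom.hom
    have hs' : ∀ g x, s' (P.ρ g x) = fun y => s' x (g⁻¹ * y) := fun g x => FDRep.hom_comm s g x
    refine ⟨LinearMap.proj 1 ∘ₗ s', fun x => ?_⟩
    have h1 : (e.hom.hom.hom : (G → P) →ₗ[k] P) (s' x) = x :=
      congrArg (fun t : P ⟶ P => (t.hom.hom.hom : P →ₗ[k] P) x) hs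
    rw [he] at h1
    refine Eq.trans ?_ h1
    refine Finset.sum_congr rfl fun g _ => ?_
    simp [hs']
  · rintro ⟨θ, hθ⟩
    refine ⟨fun {E X} f e he => ?_⟩
    obtain ⟨s, hs⟩ := LinearMap.exists_rightInverse_of_surjective (e.hom.hom.hom : E →ₗ[k] X)
      (LinearMap.range_eq_top.2 (FDRep.surjective_of_epi e))
    let t : P →ₗ[k] E := ∑ g : G, E.ρ g ∘ₗ s ∘ₗ (f.hom.hom.hom : P →ₗ[k] X) ∘ₗ θ ∘ₗ P.ρ g⁻¹
    refine ⟨FDRep.homMk t (fun g x => ?_), ?_⟩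
    · simp only [t, LinearMap.sum_apply, LinearMap.comp_apply, map_sum]
      rw [← Equiv.sum_comp (Equiv.mulLeft g)]
      refine Finset.sum_congr rfl fun y _ => ?_
      simp [← Module.End.mul_apply, ← map_mul]
    · ext x
      change (e.hom.hom.hom : E →ₗ[k] X) (t x) = (f.hom.hom.hom : P →ₗ[k] X) x
      simp only [t, LinearMap.sum_apply, LinearMap.comp_apply, map_sum, FDRep.hom_comm]
      conv_rhs => rw [← hθ x]
      rw [map_sum]
      refine Finset.sum_congr rfl fun y _ => ?_
      rw [FDRep.hom_comm]
      congr 1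
      exact LinearMap.congr_fun hs _

lemma rep_conj_aux {V : Type u} [AddCommGroup V] [Module k V] (ρ : Representation k G V)
    (θ : V →ₗ[k] V) (a b t : G) (h : b = a⁻¹) (x : V) :
    ρ a (ρ t (θ (ρ t⁻¹ (ρ b x)))) = ρ (a * t) (θ (ρ (a * t)⁻¹ x)) := by
  subst h
  rw [map_mul, mul_inv_rev, map_mul, Module.End.mul_apply, Module.End.mul_apply]

lemma rep_comm_aux {V : Type u} [AddCommGroup V] [Module k V] (ρ : Representation k G V)
    (a b c d : G) (h : a * b = c * d) (x : V) : ρ a (ρ b x) = ρ c (ρ d x) := by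
  rw [← Module.End.mul_apply, ← map_mul, h, map_mul, Module.End.mul_apply]

open Classical in
lemma projective_res [Finite G] (φ : H →* G) (hφ : Function.Injective φ) (P : FDRep k G)
    (hP : Projective P) : Projective ((Action.res (FGModuleCat k) φ).obj P) := by
  have := Fintype.ofFinite G
  have : Finite H := Finite.of_injective φ hφ
  have := Fintype.ofFinite H
  obtain ⟨θ, hθ⟩ := (projective_iff_trace P).1 hP
  obtain ⟨T, hT, -⟩ := Subgroup.exists_isComplement_right φ.range 1
  let eH : H ≃ φ.range := (MonoidHom.ofInjective hφ).toEquiv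
  have hb : Function.Bijective (fun q : H × T => φ q.1 * (q.2 : G)) := by
    have := hT
    exact this.comp ((eH.prodCongr (Equiv.refl T)).bijective)
  refine (projective_iff_trace _).2 ⟨∑ t : T, P.ρ t ∘ₗ θ ∘ₗ P.ρ (t : G)⁻¹, fun x => ?_⟩
  change ∑ g : H, P.ρ (φ g) ((∑ t : T, P.ρ t ∘ₗ θ ∘ₗ P.ρ (t : G)⁻¹) (P.ρ (φ g⁻¹) x)) = x
  conv_rhs => rw [← hθ x, ← (Equiv.ofBijective _ hb).sum_comp, Fintype.sum_prod_type]
  refine Finset.sum_congr rfl fun g _ => ?_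
  simp only [LinearMap.sum_apply, LinearMap.comp_apply, map_sum]
  refine Finset.sum_congr rfl fun t _ => ?_
  exact rep_conj_aux P.ρ θ (φ g) (φ g⁻¹) t (map_inv φ g) x


lemma FactorsThroughProjective.res [Finite G] (φ : H →* G) (hφ : Function.Injective φ)
    {X Y : FDRep k G} {f : X ⟶ Y} (h : FactorsThroughProjective f) :
    FactorsThroughProjective ((Action.res (FGModuleCat k) φ).map f) := by
  obtain ⟨W, hW, a, b, rfl⟩ := h
  exact ⟨_, projective_res φ hφ W hW, (Action.res (FGModuleCat k) φ).map a,
    (Action.res (FGModuleCat k) φ).map b, ((Action.res (FGModuleCat k) φ).map_comp a b).symm⟩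

variable (k) in
/-- Restriction of stable modules along an injective group homomorphism. -/
def stRes [Finite G] (φ : H →* G) (hφ : Function.Injective φ) : StMod k G ⥤ StMod k H :=
  CategoryTheory.Quotient.lift _ (Action.res (FGModuleCat k) φ ⋙ toStMod k H) (fun _ _ f g h => by
    refine (toStMod_map_eq_iff _ _).2 ?_
    exact FactorsThroughProjective.res φ hφ h)

lemma stRes_map [Finite G] (φ : H →* G) (hφ : Function.Injective φ) {X Y : FDRep k G} (f : X ⟶ Y) :
    (stRes k φ hφ).map ((toStMod k G).map f) =
      (toStMod k H).map ((Action.res (FGModuleCat k) φ).map f) := rfl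

lemma toSkeleton_surjective (x : Skeleton (StMod k G)) :
    ∃ M : FDRep k G, toSkeleton ((toStMod k G).obj M) = x :=
  ⟨x.out.as, Quotient.out_eq x⟩

variable (k) in
/-- Restriction `T_k(G) → T_k(H)` along an injective group homomorphism `H → G`. -/
noncomputable def Tk.res [Finite G] (φ : H →* G) (hφ : Function.Injective φ) : Tk k G →* Tk k H :=
  Units.map
    { toFun := (stRes k φ hφ).mapSkeleton.obj
      map_one' := by
        rw [Skeleton.one_eq, Functor.mapSkeleton_obj_toSkeleton]
        exact toSkeleton_eq_toSkeleton_iff.2 ⟨(toStMod k H).mapIso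
          (X := (Action.res (FGModuleCat k) φ).obj (𝟙_ (FDRep k G))) (Y := 𝟙_ (FDRep k H))
          (Action.mkIso (Iso.refl _) (fun _ => rfl))⟩
      map_mul' := fun x y => by
        obtain ⟨M, rfl⟩ := toSkeleton_surjective x
        obtain ⟨N, rfl⟩ := toSkeleton_surjective y
        simp only [← Skeleton.toSkeleton_tensorObj, Functor.mapSkeleton_obj_toSkeleton]
        exact toSkeleton_eq_toSkeleton_iff.2 ⟨(toStMod k H).mapIso
          (X := (Action.res (FGModuleCat k) φ).obj (M ⊗ N))
          (Y := (Action.res (FGModuleCat k) φ).obj M ⊗ (Action.res (FGModuleCat k) φ).obj N)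
          (Action.mkIso (Iso.refl _) (fun _ => rfl))⟩ }

lemma Tk.res_val [Finite G] (φ : H →* G) (hφ : Function.Injective φ) (x : Tk k G) (M : FDRep k G)
    (hM : x.val = toSkeleton ((toStMod k G).obj M)) :
    (Tk.res k φ hφ x).val = toSkeleton ((toStMod k H).obj ((Action.res _ φ).obj M)) := by
  change (stRes k φ hφ).mapSkeleton.obj x.val = _
  rw [hM, Functor.mapSkeleton_obj_toSkeleton]
  rfl

lemma Tk.exists_rep (x : Tk k G) : ∃ M : FDRep k G, x.val = toSkeleton ((toStMod k G).obj M) :=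
  ⟨x.val.out.as, (Quotient.out_eq x.val).symm⟩

lemma Tk.res_id [Finite G] : Tk.res k (MonoidHom.id G) Function.injective_id = MonoidHom.id _ := by
  ext x
  obtain ⟨M, hM⟩ := Tk.exists_rep x
  rw [Tk.res_val _ _ x M hM, MonoidHom.id_apply, hM]
  rfl

lemma Tk.res_comp {L : Type u} [Group L] [Finite G] [Finite H] (φ : H →* G)
    (hφ : Function.Injective φ) (ψ : L →* H) (hψ : Function.Injective ψ) :
    (Tk.res k ψ hψ).comp (Tk.res k φ hφ) = Tk.res k (φ.comp ψ) (hφ.comp hψ) := by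
  ext x
  obtain ⟨M, hM⟩ := Tk.exists_rep x
  rw [MonoidHom.comp_apply, Tk.res_val _ _ _ _ (Tk.res_val _ _ x M hM), Tk.res_val _ _ x M hM]
  rfl

lemma Tk.res_conj [Finite G] (φ φ' : H →* G) (hφ : Function.Injective φ)
    (hφ' : Function.Injective φ') (c : G) (h : ∀ x, φ' x = c⁻¹ * φ x * c) :
    Tk.res k φ hφ = Tk.res k φ' hφ' := by
  ext x
  obtain ⟨M, hM⟩ := Tk.exists_rep x
  rw [Tk.res_val _ _ x M hM, Tk.res_val _ _ x M hM]
  let M₁ : FDRep k H := (Action.res _ φ).obj M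
  let M₂ : FDRep k H := (Action.res _ φ').obj M
  let e : M₁ ≅ M₂ :=
    { hom := FDRep.homMk (X := M₁) (Y := M₂) (M.ρ c⁻¹) (fun g x =>
        rep_comm_aux M.ρ c⁻¹ (φ g) (φ' g) c⁻¹ (by simp [h, mul_assoc]) x)
      inv := FDRep.homMk (X := M₂) (Y := M₁) (M.ρ c) (fun g x =>
        rep_comm_aux M.ρ c (φ' g) (φ g) c (by simp [h, mul_assoc]) x)
      hom_inv_id := by
        ext x
        exact (rep_comm_aux M.ρ c c⁻¹ 1 1 (by simp) x).trans (by simp; rfl)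
      inv_hom_id := by
        ext x
        exact (rep_comm_aux M.ρ c⁻¹ c 1 1 (by simp) x).trans (by simp; rfl) }
  exact toSkeleton_eq_toSkeleton_iff.2 ⟨(toStMod k H).mapIso e⟩

end Restriction


section OrbitCategory

/-- Objects `G/H` of the orbit category `O(G)`, one for each subgroup `H` of `G`. -/
structure OrbitCat (G : Type u) [Group G] : Type u where
  subgroup : Subgroup G

variable {G : Type u} [Group G]

/-- Morphisms `G/H → G/K` are the `G`-equivariant maps. -/
instance : Category.{u} (OrbitCat G) where
  Hom X Y := (G ⧸ X.subgroup) →[G] (G ⧸ Y.subgroup)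
  id X := MulActionHom.id G
  comp f g := g.comp f

/-- The `G`-map underlying a morphism of the orbit category. -/
def OrbitCat.Hom.toFun {X Y : OrbitCat G} (f : X ⟶ Y) : (G ⧸ X.subgroup) →[G] (G ⧸ Y.subgroup) := f

namespace OrbitCat

lemma hom_ext {X Y : OrbitCat G} {f g : X ⟶ Y}
    (h : Hom.toFun f ((1 : G) : G ⧸ X.subgroup) = Hom.toFun g ((1 : G) : G ⧸ X.subgroup)) :
    f = g := by
  refine MulActionHom.ext fun x => ?_
  obtain ⟨a, rfl⟩ := QuotientGroup.mk_surjective x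
  have h1 : ((a : G) : G ⧸ X.subgroup) = a • ((1 : G) : G ⧸ X.subgroup) := by
    simp
  rw [h1]
  exact ((Hom.toFun f).map_smul a _).trans ((congrArg (a • ·) h).trans ((Hom.toFun g).map_smul a _).symm)

/-- The morphism `f : G/H → G/K` is given by `xH ↦ xgK`. -/
def Represents {X Y : OrbitCat G} (f : X ⟶ Y) (g : G) : Prop :=
  Hom.toFun f ((1 : G) : G ⧸ X.subgroup) = (g : G ⧸ Y.subgroup)

lemma Represents.conj_mem {X Y : OrbitCat G} {f : X ⟶ Y} {g : G} (h : Represents f g)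
    (x : X.subgroup) : g⁻¹ * (x : G) * g ∈ Y.subgroup := by
  have h1 : (x : G) • ((1 : G) : G ⧸ X.subgroup) = ((1 : G) : G ⧸ X.subgroup) := by
    rw [MulAction.Quotient.smul_coe, QuotientGroup.eq]
    simp
  have h2 := (Hom.toFun f).map_smul (x : G) ((1 : G) : G ⧸ X.subgroup)
  rw [h1] at h2
  unfold Represents at h
  rw [h, MulAction.Quotient.smul_coe, QuotientGroup.eq] at h2
  simpa [mul_assoc] using h2

/-- If `f : G/H → G/K` is `xH ↦ xgK`, the homomorphism `H → K`, `x ↦ g⁻¹ x g`. -/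
def Represents.conjHom {X Y : OrbitCat G} {f : X ⟶ Y} {g : G} (h : Represents f g) :
    X.subgroup →* Y.subgroup where
  toFun x := ⟨g⁻¹ * x * g, h.conj_mem x⟩
  map_one' := by simp
  map_mul' x y := by ext; simp [mul_assoc]

lemma Represents.conjHom_injective {X Y : OrbitCat G} {f : X ⟶ Y} {g : G}
    (h : Represents f g) : Function.Injective h.conjHom := by
  intro x y hxy
  have := congrArg Subtype.val hxy
  simpa [Represents.conjHom] using this

lemma represents_out {X Y : OrbitCat G} (f : X ⟶ Y) :
    Represents f (Hom.toFun f ((1 : G) : G ⧸ X.subgroup)).out :=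
  (QuotientGroup.out_eq' _).symm

lemma represents_id (X : OrbitCat G) : Represents (𝟙 X) 1 := rfl

lemma Represents.comp {X Y Z : OrbitCat G} {f : X ⟶ Y} {f' : Y ⟶ Z} {g g' : G}
    (h : Represents f g) (h' : Represents f' g') : Represents (f ≫ f') (g * g') := by
  change Hom.toFun f' (Hom.toFun f _) = _
  unfold Represents at h h'
  rw [h]
  have h1 : ((g : G) : G ⧸ Y.subgroup) = g • ((1 : G) : G ⧸ Y.subgroup) := by
    simp
  rw [h1, (Hom.toFun f').map_smul, h']
  simp

variable (k : Type u) [Field k] [Finite G]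

lemma Represents.tkRes_eq {X Y : OrbitCat G} {f : X ⟶ Y} {g g' : G}
    (h : Represents f g) (h' : Represents f g') :
    Tk.res k h.conjHom h.conjHom_injective = Tk.res k h'.conjHom h'.conjHom_injective := by
  have hc : g⁻¹ * g' ∈ Y.subgroup := QuotientGroup.eq.1 (h.symm.trans h')
  refine Tk.res_conj _ _ _ _ ⟨g⁻¹ * g', hc⟩ fun x => ?_
  ext
  simp [Represents.conjHom, mul_assoc]

/-- The map `T_k(K) → T_k(H)` induced by `f : G/H → G/K`: restriction along `x ↦ g⁻¹ x g`, where
`f(H) = gK`; by `Represents.tkMap_eq` it does not depend on the choice of `g`. -/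
noncomputable def tkMap {X Y : OrbitCat G} (f : X ⟶ Y) : Tk k Y.subgroup →* Tk k X.subgroup :=
  Tk.res k (represents_out f).conjHom (represents_out f).conjHom_injective

lemma Represents.tkMap_eq {X Y : OrbitCat G} {f : X ⟶ Y} {g : G} (h : Represents f g) :
    tkMap k f = Tk.res k h.conjHom h.conjHom_injective :=
  (represents_out f).tkRes_eq k h

lemma tkMap_id (X : OrbitCat G) : tkMap k (𝟙 X) = MonoidHom.id _ := by
  rw [(represents_id X).tkMap_eq k, ← Tk.res_id]
  congr 1
  ext; simp [Represents.conjHom]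

lemma tkMap_comp {X Y Z : OrbitCat G} (f : X ⟶ Y) (f' : Y ⟶ Z) :
    tkMap k (f ≫ f') = (tkMap k f).comp (tkMap k f') := by
  rw [((represents_out f).comp (represents_out f')).tkMap_eq k, tkMap, tkMap, Tk.res_comp]
  congr 1
  ext; simp [Represents.conjHom, mul_assoc]

end OrbitCat

open Opposite

variable (G) in
/-- Presheaves of abelian groups on `O(G)`, i.e. `ℤO(G)`-modules. -/
abbrev AbPsh : Type (u + 2) := (OrbitCat G)ᵒᵖ ⥤ AddCommGrpCat.{u + 1}

variable (G) in
/-- The presheaf `Pic : G/H ↦ T_k(H)` on `O(G)` (written additively). -/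
noncomputable def picPresheaf (k : Type u) [Field k] [Finite G] : AbPsh G where
  obj X := AddCommGrpCat.of (Additive (Tk k X.unop.subgroup))
  map f := AddCommGrpCat.ofHom (MonoidHom.toAdditive (OrbitCat.tkMap k f.unop))
  map_id X := by
    rw [unop_id, OrbitCat.tkMap_id]; rfl
  map_comp f g := by
    rw [unop_comp, OrbitCat.tkMap_comp]; rfl

variable (G) in
/-- The terminal object `G/G`. -/
def OrbitCat.top : OrbitCat G := ⟨⊤⟩

instance : Subsingleton (G ⧸ (⊤ : Subgroup G)) := QuotientGroup.subsingleton_quotient_top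

/-- The unique map `G/H → G/G`. -/
def OrbitCat.toTop (X : OrbitCat G) : X ⟶ OrbitCat.top G :=
  (⟨fun _ => ((1 : G) : G ⧸ (⊤ : Subgroup G)), fun _ _ => Subsingleton.elim _ _⟩ :
    (G ⧸ X.subgroup) →[G] (G ⧸ (⊤ : Subgroup G)))

instance (X : OrbitCat G) : Subsingleton (X ⟶ OrbitCat.top G) :=
  ⟨fun _ _ => OrbitCat.hom_ext (Subsingleton.elim (α := G ⧸ (⊤ : Subgroup G)) _ _)⟩

/-- Covering sieves for the sipp topology on `O(G)`: every point `u` of the target has a preimage `v`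
under some map of the sieve such that `[Stab(u) : Stab(v)]` is prime to `p`. -/
def IsSippCovering (p : ℕ) {X : OrbitCat G} (S : Sieve X) : Prop :=
  ∀ u : G ⧸ X.subgroup, ∃ (Y : OrbitCat G) (f : Y ⟶ X) (v : G ⧸ Y.subgroup),
    S f ∧ OrbitCat.Hom.toFun f v = u ∧
      p.Coprime ((MulAction.stabilizer G v).relIndex (MulAction.stabilizer G u))

/-- The minimal covering sieve `S^min`: the intersection of all sipp-covering sieves. -/
def minSieve (p : ℕ) (X : OrbitCat G) : Sieve X := sInf {S | IsSippCovering p S}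

lemma toTop_mem_minSieve [Finite G] (p : ℕ) [Fact p.Prime] (X : OrbitCat G) (hX : IsPGroup p X.subgroup) :
    minSieve p (OrbitCat.top G) X.toTop := by
  rintro S hS
  obtain ⟨Y, f, v, hf, -, hp⟩ := hS ((1 : G) : G ⧸ (⊤ : Subgroup G))
  have h1 : MulAction.stabilizer G (((1 : G) : G ⧸ (⊤ : Subgroup G)) :
      G ⧸ (OrbitCat.top G).subgroup) = ⊤ :=
    eq_top_iff.2 fun g _ => Subsingleton.elim (α := G ⧸ (⊤ : Subgroup G)) _ _
  have hp : p.Coprime ((MulAction.stabilizer G v).relIndex ⊤) := h1 ▸ hp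
  rw [Subgroup.relIndex_top_right, MulAction.index_stabilizer, MulAction.orbit_eq_univ, Set.ncard_univ] at hp
  obtain ⟨y, hy⟩ := hX.nonempty_fixed_point_of_prime_not_dvd_card (G ⧸ Y.subgroup)
    (fun h => (Nat.Prime.coprime_iff_not_dvd Fact.out).1 hp h)
  obtain ⟨g, rfl⟩ := QuotientGroup.mk_surjective y
  let t : (G ⧸ X.subgroup) →[G] (G ⧸ Y.subgroup) :=
    ⟨fun x => Quotient.liftOn' x (fun a => ((a * g : G) : G ⧸ Y.subgroup)) (fun a b hab => by
      have := hy ⟨a⁻¹ * b, QuotientGroup.leftRel_apply.1 hab⟩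
      have h2 : (a⁻¹ * b) • (g : G ⧸ Y.subgroup) = (g : G ⧸ Y.subgroup) := this
      have h3 := congrArg (a • ·) h2
      rw [smul_smul, mul_inv_cancel_left] at h3
      exact h3.symm), by
      rintro a ⟨b⟩
      exact congrArg QuotientGroup.mk (mul_assoc a b g)⟩
  have := S.downward_closed hf (show X ⟶ Y from t)
  rwa [Subsingleton.elim ((show X ⟶ Y from t) ≫ f) X.toTop] at this

/-- The constant presheaf `ℤ`. -/
noncomputable def constZ (C : Type u) [Category.{u} C] : Cᵒᵖ ⥤ AddCommGrpCat.{u + 1} :=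
  (Functor.const _).obj (AddCommGrpCat.of (ULift.{u + 1} ℤ))

/-- The free abelian presheaf `ℤS` on a sieve `S`, regarded as a presheaf of sets. -/
noncomputable def freeSieve {X : OrbitCat G} (S : Sieve X) : AbPsh G :=
  S.functor ⋙ uliftFunctor.{u + 1, u} ⋙ AddCommGrpCat.free

/-- The canonical map `ℤS → ℤ` sending every element of `S` to `1`. -/
noncomputable def freeSieveToConst {X : OrbitCat G} (S : Sieve X) :
    freeSieve S ⟶ constZ (OrbitCat G) where
  app _ := AddCommGrpCat.ofHom (FreeAbelianGroup.lift (fun _ => ULift.up 1))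
  naturality X Y f := by
    refine AddCommGrpCat.hom_ext (FreeAbelianGroup.lift_ext _ _ fun x => ?_)
    change FreeAbelianGroup.lift _ (FreeAbelianGroup.map _ (FreeAbelianGroup.of x)) =
      FreeAbelianGroup.lift _ (FreeAbelianGroup.of x)
    exact (FreeAbelianGroup.lift_apply_of _ _).trans (FreeAbelianGroup.lift_apply_of _ _).symm

lemma freeAbelianGroup_lift_injective (α : Type (u + 1)) [Subsingleton α] :
    Function.Injective (FreeAbelianGroup.lift (fun _ : α => ULift.up.{u + 1} (1 : ℤ))) := by
  rw [injective_iff_map_eq_zero]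
  intro x hx
  rcases isEmpty_or_nonempty α with h | ⟨⟨a⟩⟩
  · exact Subsingleton.elim _ _
  · have key : ∀ x : FreeAbelianGroup α, ∃ n : ℤ, x = n • FreeAbelianGroup.of a := fun x => by
      induction x using FreeAbelianGroup.induction_on with
      | zero => exact ⟨0, by simp⟩
      | of b => exact ⟨1, by simp [Subsingleton.elim b a]⟩
      | neg b _ => exact ⟨-1, by simp [Subsingleton.elim b a]⟩
      | add x y hx hy =>
        obtain ⟨n, rfl⟩ := hx
        obtain ⟨m, rfl⟩ := hy
        exact ⟨n + m, (add_zsmul _ _ _).symm⟩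
    obtain ⟨n, rfl⟩ := key x
    rw [map_zsmul, FreeAbelianGroup.lift_apply_of] at hx
    have := congrArg ULift.down hx
    simp at this
    simp [this]

instance (p : ℕ) : Mono (freeSieveToConst (minSieve p (OrbitCat.top G))) := by
  have : ∀ X, Mono ((freeSieveToConst (minSieve p (OrbitCat.top G))).app X) := fun X => by
    refine (AddCommGrpCat.mono_iff_injective _).2 ?_
    have : Subsingleton ((minSieve p (OrbitCat.top G)).functor.obj X) :=
      inferInstanceAs (Subsingleton {f : X.unop ⟶ OrbitCat.top G // _})
    have : Subsingleton (((minSieve p (OrbitCat.top G)).functor ⋙ uliftFunctor.{u + 1, u}).obj X) :=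
      inferInstanceAs (Subsingleton (ULift _))
    exact freeAbelianGroup_lift_injective _
  exact NatTrans.mono_of_mono_app _

variable (G) in
/-- The quotient presheaf `Q = ℤ / ℤS^min_{G/G}`. -/
noncomputable def quotPresheaf (p : ℕ) : AbPsh G :=
  cokernel (freeSieveToConst (minSieve p (OrbitCat.top G)))

variable (G) in
/-- The projection `ℤ → Q`. -/
noncomputable def quotMap (p : ℕ) : constZ (OrbitCat G) ⟶ quotPresheaf G p :=
  cokernel.π (freeSieveToConst (minSieve p (OrbitCat.top G)))

variable (G) in
/-- The sequence `0 → ℤS^min_{G/G} → ℤ → Q → 0`. -/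
noncomputable def sippComplex (p : ℕ) : ShortComplex (AbPsh G) :=
  ShortComplex.mk (freeSieveToConst (minSieve p (OrbitCat.top G))) (quotMap G p)
    (cokernel.condition _)

lemma sippComplex_shortExact (p : ℕ) : (sippComplex G p).ShortExact where
  exact := ShortComplex.exact_cokernel _
  mono_f := inferInstanceAs (Mono (freeSieveToConst _))
  epi_g := coequalizer.π_epi

instance : HasExt.{u + 2} (AbPsh G) := HasExt.standard _

/-- The connecting map `Hom(ℤS^min_{G/G}, M) → Ext¹(Q, M)` over `ℤO(G)`: Yoneda product with the class
of the short exact sequence `0 → ℤS^min_{G/G} → ℤ → Q → 0`. -/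
noncomputable def connecting (p : ℕ) (M : AbPsh G) :
    (freeSieve (minSieve p (OrbitCat.top G)) ⟶ M) →+ Abelian.Ext.{u + 2} (quotPresheaf G p) M 1 :=
  ((sippComplex_shortExact p).extClass.precomp M (add_zero 1)).comp
    Abelian.Ext.addEquiv₀.symm.toAddMonoidHom

variable (G) in
/-- The orbits `G/Q` with `Q` a nontrivial `p`-subgroup. -/
def IsNontrivialPOrbit (p : ℕ) : ObjectProperty (OrbitCat G) :=
  fun X => IsPGroup p X.subgroup ∧ X.subgroup ≠ ⊥

variable (G) in
/-- The full subcategory `O_p°(G)` of `O(G)` on the `G/Q` with `Q` a nontrivial `p`-subgroup. -/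
abbrev POrbitCat (p : ℕ) : Type u := (IsNontrivialPOrbit G p).FullSubcategory

variable (G) in
/-- The inclusion `O_p°(G) → O(G)`. -/
abbrev POrbitCat.incl (p : ℕ) : POrbitCat G p ⥤ OrbitCat G := (IsNontrivialPOrbit G p).ι

/-- The generator of `ℤS(Y)` given by a morphism `f : Y → X` in `S`. -/
noncomputable def freeSieveGen {X Y : OrbitCat G} (S : Sieve X) (f : Y ⟶ X) (hf : S f) :
    (freeSieve S).obj (op Y) :=
  FreeAbelianGroup.of (ULift.up ⟨f, hf⟩)

lemma freeSieveGen_map {X Y Z : OrbitCat G} (S : Sieve X) (f : Y ⟶ X) (hf : S f) (g : Z ⟶ Y) :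
    (freeSieve S).map g.op (freeSieveGen S f hf) =
      freeSieveGen S (g ≫ f) (S.downward_closed hf g) :=
  FreeAbelianGroup.map_of_apply _

lemma freeSieveToConst_gen {X Y : OrbitCat G} (S : Sieve X) (f : Y ⟶ X) (hf : S f) :
    (freeSieveToConst S).app (op Y) (freeSieveGen S f hf) = ULift.up 1 :=
  FreeAbelianGroup.lift_apply_of _ _

/-- On `O_p°(G)`, the map `ℤ → ℤS^min_{G/G}` sending `1` to the generator `G/Q → G/G`; it is inverse to
the restriction of the canonical map `ℤS^min_{G/G} → ℤ`. -/
noncomputable def constToFreeSieve [Finite G] (p : ℕ) [Fact p.Prime] :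
    constZ (POrbitCat G p) ⟶
      (POrbitCat.incl G p).op ⋙ freeSieve (minSieve p (OrbitCat.top G)) where
  app X := AddCommGrpCat.ofHom
    ((zmultiplesHom ((freeSieve (minSieve p (OrbitCat.top G))).obj (op X.unop.obj))
      (freeSieveGen _ X.unop.obj.toTop (toTop_mem_minSieve p _ X.unop.property.1))).comp
      AddEquiv.ulift.toAddMonoidHom)
  naturality X Y f := by
    refine AddCommGrpCat.hom_ext (AddMonoidHom.ext fun n => ?_)
    change n.down • freeSieveGen _ _ _ = (freeSieve (minSieve p (OrbitCat.top G))).map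
      ((POrbitCat.incl G p).map f.unop).op (n.down • freeSieveGen _ _ _)
    rw [map_zsmul, freeSieveGen_map]
    congr! 2

lemma constToFreeSieve_comp [Finite G] (p : ℕ) [Fact p.Prime] :
    constToFreeSieve p ≫ Functor.whiskerLeft (POrbitCat.incl G p).op
      (freeSieveToConst (minSieve p (OrbitCat.top G))) = 𝟙 (constZ (POrbitCat G p)) := by
  ext X n
  change (freeSieveToConst _).app (op X.unop.obj) (n.down • freeSieveGen _ _ _) = n
  rw [map_zsmul, freeSieveToConst_gen]
  exact ULift.ext _ _ (by simp : n.down • (1 : ℤ) = n.down)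

/-- Restriction to `O_p°(G)`, where `ℤS^min_{G/G}` becomes `ℤ`:
`Hom_{ℤO(G)}(ℤS^min_{G/G}, M) → Hom_{ℤO_p°(G)}(ℤ, M)`. -/
noncomputable def restrictHom [Finite G] (p : ℕ) [Fact p.Prime] (M : AbPsh G) :
    (freeSieve (minSieve p (OrbitCat.top G)) ⟶ M) →+
      (constZ (POrbitCat G p) ⟶ (POrbitCat.incl G p).op ⋙ M) where
  toFun φ := constToFreeSieve p ≫ Functor.whiskerLeft (POrbitCat.incl G p).op φ
  map_zero' := by
    rw [show Functor.whiskerLeft (POrbitCat.incl G p).op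
      (0 : freeSieve (minSieve p (OrbitCat.top G)) ⟶ M) = 0 from rfl, comp_zero]
  map_add' φ ψ := by
    rw [show Functor.whiskerLeft (POrbitCat.incl G p).op (φ + ψ) =
      Functor.whiskerLeft (POrbitCat.incl G p).op φ +
        Functor.whiskerLeft (POrbitCat.incl G p).op ψ from rfl, Preadditive.comp_add]

/-- The object `G/P` of `O_p°(G)`, for a Sylow `p`-subgroup `P`, where `p` divides `|G|`. -/
def sylowOrbit [Finite G] {p : ℕ} [Fact p.Prime] (hp : p ∣ Nat.card G) (P : Sylow p G) :
    POrbitCat G p :=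
  ⟨⟨P⟩, P.isPGroup', P.ne_bot_of_dvd_card hp⟩

/-- Evaluation `Hom(ℤ, F) → F(X)`, `φ ↦ φ_X(1)`. -/
noncomputable def evalAt {C : Type u} [Category.{u} C] {F : Cᵒᵖ ⥤ AddCommGrpCat.{u + 1}}
    (X : C) : (constZ C ⟶ F) →+ F.obj (op X) where
  toFun φ := φ.app (op X) (ULift.up 1 : ULift.{u + 1} ℤ)
  map_zero' := rfl
  map_add' _ _ := rfl

end OrbitCategory

section Groups
variable (k : Type u) [Field k] {G : Type u} [Group G] [Finite G]

/-- Restriction `T_k(G) → T_k(H)` to a subgroup. -/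
noncomputable def Tk.resSubgroup (H : Subgroup G) : Tk k G →* Tk k H :=
  Tk.res k H.subtype H.subtype_injective

/-- `T_k(G, H)`, the kernel of `T_k(G) → T_k(H)`. -/
noncomputable abbrev Tk.relKer (H : Subgroup G) : Subgroup (Tk k G) := (Tk.resSubgroup k H).ker

/-- `I_k(G, H)`, the image of `T_k(G) → T_k(H)`. -/
noncomputable abbrev Tk.image (H : Subgroup G) : Subgroup (Tk k H) := (Tk.resSubgroup k H).range

end Groups
end Endotrivial
open CategoryTheory Opposite Endotrivial

/-!
The minimal covering sieve `S = S^min_{G/G}` consists of the orbits `G/R` with `R` a `p`-subgroup: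
the sieve generated by `G/P → G/G` is covering, so each `G/R` in `S` maps to `G/P` and `R` is
a `p`-group, while orbits of `p`-groups lie in every covering sieve. Combining the
two facts gives Sylow's conjugacy theorem in the form needed: every `G/R` with `R` a `p`-subgroup admits a map to `G/P`
(`exists_hom_sylow_of_mem_minSieve`).

Since `G/G` is terminal, `Hom(ℤ, M) ≅ M(G/G)` (`evalAt_top_bijective`), so morphisms `ℤ → Pic` are the
families of restrictions of an element of `T_k(G)` (`exists_evalAt_eq_resSubgroup`,
`exists_eq_resSubgroup`). Morphisms `𝔔 → Pic` are those `ℤ → Pic` vanishing on `S`, i.e. the elements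
of `T_k(G)` that restrict to zero on every `p`-subgroup; as such restrictions factor through `P`, they
form the kernel of `T_k(G) → T_k(P)`.

A morphism `ℤS → Pic` is a compatible family in the `T_k(R)`, with `R` a `p`-subgroup. The trivial
subgroup contributes nothing, because every module over the trivial group is projective and so
`T_k(1) = 0`; hence restriction to `O_p°(G)` is bijective (`restrictHom_bijective`). A family on
`O_p°(G)` is determined by its value at `G/P`, since every object maps to `G/P`
(`evalAt_sylowOrbit_injective`). By the long exact `Ext` sequence the kernel of the connecting map
consists of the morphisms that extend to `ℤ → Pic` (`connecting_eq_zero_iff`), and their values at `G/P`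
are the restrictions to `P` of elements of `T_k(G)`.
-/

open CategoryTheory Opposite Endotrivial

namespace Endotrivial

/-! ### The Picard group of the trivial group -/

lemma projective_of_subsingleton {k : Type u} [Field k] {H : Type u} [Group H] [Subsingleton H]
    (M : FDRep k H) : Projective M := by
  have : Fintype H := Fintype.ofFinite H
  refine (projective_iff_trace M).2 ⟨LinearMap.id, fun x => ?_⟩
  rw [Fintype.sum_subsingleton _ 1]
  simp

/-- Over the trivial group every map factors through a projective, so the stable category has only
zero morphisms and all its objects are isomorphic. -/
lemma Tk.subsingleton_of_subsingleton (k : Type u) [Field k] (H : Type u) [Group H]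
    [Subsingleton H] : Subsingleton (Tk k H) := by
  have hz (M N : FDRep k H) (f g : M ⟶ N) : (toStMod k H).map f = (toStMod k H).map g :=
    (toStMod_map_eq_iff f g).2 ⟨M, projective_of_subsingleton M, 𝟙 M, f - g, by simp⟩
  refine ⟨fun x y => Units.ext ?_⟩
  obtain ⟨M, hM⟩ := Tk.exists_rep x
  obtain ⟨N, hN⟩ := Tk.exists_rep y
  rw [hM, hN]
  exact toSkeleton_eq_toSkeleton_iff.2
    ⟨{ hom := (toStMod k H).map 0
       inv := (toStMod k H).map 0
       hom_inv_id := ((toStMod k H).map_comp _ _).symm.trans (hz _ _ _ (𝟙 M))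
       inv_hom_id := ((toStMod k H).map_comp _ _).symm.trans (hz _ _ _ (𝟙 N)) }⟩

/-! ### The minimal covering sieve on `G/G` -/

section OrbitCategory

variable {G : Type u} [Group G]

lemma OrbitCat.represents_toTop (X : OrbitCat G) : OrbitCat.Represents X.toTop 1 := rfl

lemma isPGroup_of_hom {p : ℕ} {X Y : OrbitCat G} (f : X ⟶ Y) (hY : IsPGroup p Y.subgroup) :
    IsPGroup p X.subgroup :=
  hY.of_injective _ (OrbitCat.represents_out f).conjHom_injective

lemma ne_bot_of_hom {X Y : OrbitCat G} (f : X ⟶ Y) (hX : X.subgroup ≠ ⊥) : Y.subgroup ≠ ⊥ := by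
  intro hY
  have : Subsingleton Y.subgroup := hY ▸ inferInstanceAs (Subsingleton (⊥ : Subgroup G))
  have := (OrbitCat.represents_out f).conjHom_injective.subsingleton
  exact hX (Subgroup.eq_bot_of_subsingleton _)

variable [Finite G] {p : ℕ} [Fact p.Prime]

lemma isSippCovering_generate_sylow (P : Sylow p G) :
    IsSippCovering p (Sieve.generate
      (Presieve.singleton (OrbitCat.toTop (⟨P⟩ : OrbitCat G)))) := by
  intro u
  refine ⟨⟨P⟩, OrbitCat.toTop _, ((1 : G) : G ⧸ (P : Subgroup G)),
    Sieve.le_generate _ _ _ (Presieve.singleton_self _),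
    Subsingleton.elim (α := G ⧸ (⊤ : Subgroup G)) _ _, ?_⟩
  have h1 : MulAction.stabilizer G u = ⊤ :=
    eq_top_iff.2 fun g _ => Subsingleton.elim (α := G ⧸ (⊤ : Subgroup G)) _ _
  have h2 : MulAction.stabilizer G ((1 : G) : G ⧸ (P : Subgroup G)) = P :=
    MulAction.stabilizer_quotient _
  rw [h1]
  refine (Nat.Prime.coprime_iff_not_dvd Fact.out).2 ?_
  intro h
  rw [Subgroup.relIndex_top_right] at h
  exact P.not_dvd_index (h2 ▸ h)

/-- Every orbit in the minimal sieve maps to `G/P`. Together with `toTop_mem_minSieve` this replaces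
the conjugacy part of Sylow's theorem. -/
lemma exists_hom_sylow_of_mem_minSieve (P : Sylow p G) {X : OrbitCat G}
    {f : X ⟶ OrbitCat.top G} (hf : minSieve p (OrbitCat.top G) f) :
    Nonempty (X ⟶ (⟨P⟩ : OrbitCat G)) := by
  obtain ⟨Y, g, h, hh, -⟩ := hf _ (isSippCovering_generate_sylow P)
  cases hh
  exact ⟨g⟩

lemma isPGroup_of_mem_minSieve {X : OrbitCat G} {f : X ⟶ OrbitCat.top G}
    (hf : minSieve p (OrbitCat.top G) f) : IsPGroup p X.subgroup :=
  let P : Sylow p G := default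
  (exists_hom_sylow_of_mem_minSieve P hf).elim fun g => isPGroup_of_hom g P.isPGroup'

end OrbitCategory

/-! ### Morphisms out of the constant presheaf -/

section ConstZ

variable {C : Type u} [Category.{u} C] {F : Cᵒᵖ ⥤ AddCommGrpCat.{u + 1}}

lemma constZ_hom_app_apply (φ : constZ C ⟶ F) (X : C) (n : ULift.{u + 1} ℤ) :
    φ.app (op X) n = n.down • evalAt X φ := by
  have hn : n = n.down • (ULift.up 1 : ULift.{u + 1} ℤ) :=
    ULift.ext _ _ (by simp : n.down = n.down • (1 : ℤ))
  exact (congrArg (φ.app (op X)).hom hn).trans (map_zsmul (φ.app (op X)).hom _ _)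

lemma constZ_hom_ext {φ ψ : constZ C ⟶ F} (h : ∀ X, evalAt X φ = evalAt X ψ) : φ = ψ := by
  ext X n
  exact (constZ_hom_app_apply φ X.unop n).trans
    ((congrArg (n.down • ·) (h X.unop)).trans (constZ_hom_app_apply ψ X.unop n).symm)

lemma map_evalAt (φ : constZ C ⟶ F) {X Y : C} (f : X ⟶ Y) :
    F.map f.op (evalAt Y φ) = evalAt X φ :=
  (congrArg (fun t => t.hom (ULift.up 1 : ULift.{u + 1} ℤ)) (φ.naturality f.op)).symm

/-- The morphism `ℤ → F` given by a compatible family of elements of `F`. -/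
noncomputable def constZHomMk (s : ∀ X : C, F.obj (op X))
    (hs : ∀ {X Y : C} (f : X ⟶ Y), F.map f.op (s Y) = s X) : constZ C ⟶ F where
  app X := AddCommGrpCat.ofHom ((zmultiplesHom (F.obj X) (s X.unop)).comp
    AddEquiv.ulift.toAddMonoidHom)
  naturality X Y f := by
    refine AddCommGrpCat.hom_ext (AddMonoidHom.ext fun n => ?_)
    change n.down • s Y.unop = F.map f (n.down • s X.unop)
    rw [map_zsmul]
    exact congrArg (n.down • ·) (hs f.unop).symm

lemma evalAt_constZHomMk (s : ∀ X : C, F.obj (op X))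
    (hs : ∀ {X Y : C} (f : X ⟶ Y), F.map f.op (s Y) = s X) (X : C) :
    evalAt X (constZHomMk s hs) = s X :=
  one_zsmul _

end ConstZ

/-! ### Morphisms out of `ℤS` and its cokernel -/

section FreeSieve

variable {G : Type u} [Group G] {M : AbPsh G}

lemma freeSieve_hom_ext {X : OrbitCat G} {S : Sieve X} {φ ψ : freeSieve S ⟶ M}
    (h : ∀ (Y : OrbitCat G) (f : Y ⟶ X) (hf : S f),
      φ.app (op Y) (freeSieveGen S f hf) = ψ.app (op Y) (freeSieveGen S f hf)) : φ = ψ := by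
  refine NatTrans.ext (funext fun Y => AddCommGrpCat.hom_ext ?_)
  exact FreeAbelianGroup.lift_ext _ _ fun x => h Y.unop x.down.1 x.down.2

/-- The morphism `ℤS → M` given by a compatible family of elements of `M` indexed by `S`. -/
noncomputable def freeSieveHomMk {X : OrbitCat G} (S : Sieve X)
    (s : ∀ (Y : OrbitCat G) (f : Y ⟶ X), S f → M.obj (op Y))
    (hs : ∀ (Y Z : OrbitCat G) (f : Y ⟶ X) (hf : S f) (g : Z ⟶ Y),
      M.map g.op (s Y f hf) = s Z (g ≫ f) (S.downward_closed hf g)) :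
    freeSieve S ⟶ M where
  app Y := AddCommGrpCat.ofHom
    (FreeAbelianGroup.lift (fun f : ULift.{u + 1} {f : Y.unop ⟶ X // S f} =>
      s Y.unop f.down.1 f.down.2))
  naturality Y Z g := by
    refine AddCommGrpCat.hom_ext (FreeAbelianGroup.lift_ext _ _ fun f => ?_)
    change FreeAbelianGroup.lift _ (FreeAbelianGroup.map _ (FreeAbelianGroup.of f)) =
      M.map g (FreeAbelianGroup.lift _ (FreeAbelianGroup.of f))
    refine (FreeAbelianGroup.lift_apply_of _ _).trans
      (Eq.trans ?_ (congrArg (M.map g).hom (FreeAbelianGroup.lift_apply_of _ _).symm))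
    exact (hs _ _ f.down.1 f.down.2 g.unop).symm

lemma freeSieveHomMk_gen {X : OrbitCat G} (S : Sieve X)
    (s : ∀ (Y : OrbitCat G) (f : Y ⟶ X), S f → M.obj (op Y))
    (hs : ∀ (Y Z : OrbitCat G) (f : Y ⟶ X) (hf : S f) (g : Z ⟶ Y),
      M.map g.op (s Y f hf) = s Z (g ≫ f) (S.downward_closed hf g))
    {Y : OrbitCat G} (f : Y ⟶ X) (hf : S f) :
    (freeSieveHomMk S s hs).app (op Y) (freeSieveGen S f hf) = s Y f hf :=
  FreeAbelianGroup.lift_apply_of _ _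

lemma freeSieveToConst_comp_gen {X Y : OrbitCat G} (S : Sieve X) (ψ : constZ (OrbitCat G) ⟶ M)
    (f : Y ⟶ X) (hf : S f) :
    (freeSieveToConst S ≫ ψ).app (op Y) (freeSieveGen S f hf) = evalAt Y ψ :=
  congrArg (ψ.app (op Y)).hom (freeSieveToConst_gen S f hf)

/-- The Yoneda lemma for the terminal object `G/G`. -/
lemma evalAt_top_bijective (M : AbPsh G) :
    Function.Bijective (evalAt (F := M) (OrbitCat.top G)) := by
  refine ⟨fun φ ψ h => constZ_hom_ext fun X => ?_, fun x => ?_⟩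
  · rw [← map_evalAt φ X.toTop, ← map_evalAt ψ X.toTop, h]
  · refine ⟨constZHomMk (fun X => M.map X.toTop.op x) fun {X Y} f => ?_, ?_⟩
    · rw [← ConcreteCategory.comp_apply, ← M.map_comp, ← op_comp,
        Subsingleton.elim (f ≫ Y.toTop) X.toTop]
    · rw [evalAt_constZHomMk, Subsingleton.elim (OrbitCat.top G).toTop (𝟙 _), op_id, M.map_id]
      rfl

/-- Exactness of `Hom(ℤ, M) → Hom(ℤS, M) → Ext¹(𝔔, M)`. -/
lemma connecting_eq_zero_iff (p : ℕ) (φ : freeSieve (minSieve p (OrbitCat.top G)) ⟶ M) :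
    connecting p M φ = 0 ↔
      ∃ ψ : constZ (OrbitCat G) ⟶ M, freeSieveToConst (minSieve p (OrbitCat.top G)) ≫ ψ = φ := by
  constructor
  · intro h
    obtain ⟨x, hx⟩ := Abelian.Ext.contravariant_sequence_exact₁ (sippComplex_shortExact p) M
      (Abelian.Ext.mk₀ φ) (add_zero 1) h
    obtain ⟨ψ, rfl⟩ := (Abelian.Ext.mk₀_bijective _ _).2 x
    rw [Abelian.Ext.mk₀_comp_mk₀] at hx
    exact ⟨ψ, (Abelian.Ext.mk₀_bijective _ _).1 hx⟩
  · rintro ⟨ψ, rfl⟩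
    exact (congrArg ((sippComplex_shortExact p).extClass.comp · (add_zero 1))
      (Abelian.Ext.mk₀_comp_mk₀ (sippComplex G p).f ψ)).symm.trans
        ((sippComplex_shortExact p).extClass_comp_assoc _)

/-- Exactness of `Hom(𝔔, M) → Hom(ℤ, M) → Hom(ℤS, M)`, with the vanishing in `Hom(ℤS, M)` tested on the
generators of `ℤS`. -/
lemma exists_quotMap_comp_eq_iff (p : ℕ) (ψ : constZ (OrbitCat G) ⟶ M) :
    (∃ χ : quotPresheaf G p ⟶ M, quotMap G p ≫ χ = ψ) ↔
      ∀ X : OrbitCat G, minSieve p (OrbitCat.top G) X.toTop → evalAt X ψ = 0 := by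
  constructor
  · rintro ⟨χ, rfl⟩ X hX
    rw [← freeSieveToConst_comp_gen _ _ X.toTop hX, ← Category.assoc]
    have : freeSieveToConst (minSieve p (OrbitCat.top G)) ≫ quotMap G p = 0 :=
      Limits.cokernel.condition _
    rw [this, Limits.zero_comp]
    rfl
  · intro h
    refine ⟨Limits.cokernel.desc _ ψ (freeSieve_hom_ext fun Y f hf => ?_),
      Limits.cokernel.π_desc _ _ _⟩
    obtain rfl := Subsingleton.elim Y.toTop f
    exact (freeSieveToConst_comp_gen _ ψ _ hf).trans (h Y hf)

variable [Finite G] {p : ℕ} [Fact p.Prime]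

lemma evalAt_restrictHom (φ : freeSieve (minSieve p (OrbitCat.top G)) ⟶ M) (X : POrbitCat G p) :
    evalAt X (restrictHom p M φ) = φ.app (op X.obj)
      (freeSieveGen _ X.obj.toTop (toTop_mem_minSieve p _ X.property.1)) :=
  congrArg (φ.app (op X.obj)).hom (one_zsmul _)

/-- The sieve consists of the objects of `O_p°(G)` together with `G/1`, so for `M(G/1) = 0` a morphism
`ℤS → M` is the same as a compatible family on `O_p°(G)`. -/
lemma restrictHom_bijective (h0 : ∀ X : OrbitCat G, X.subgroup = ⊥ → Subsingleton (M.obj (op X))) :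
    Function.Bijective (restrictHom p M) := by
  classical
  have hsub (Y : OrbitCat G) (f : Y ⟶ OrbitCat.top G) (hf : minSieve p (OrbitCat.top G) f)
      (hY : ¬ IsNontrivialPOrbit G p Y) : Subsingleton (M.obj (op Y)) :=
    h0 Y (by_contra fun h => hY ⟨isPGroup_of_mem_minSieve hf, h⟩)
  constructor
  · intro φ ψ h
    refine freeSieve_hom_ext fun Y f hf => ?_
    obtain rfl := Subsingleton.elim Y.toTop f
    by_cases hY : IsNontrivialPOrbit G p Y
    · rw [← evalAt_restrictHom φ ⟨Y, hY⟩, ← evalAt_restrictHom ψ ⟨Y, hY⟩, h]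
    · exact (hsub Y _ hf hY).elim _ _
  · intro θ
    -- Extend the family by zero at `G/1`, the only orbit of the sieve outside `O_p°(G)`.
    refine ⟨freeSieveHomMk _
      (fun Y _ _ => if hY : IsNontrivialPOrbit G p Y then
        evalAt (F := (POrbitCat.incl G p).op ⋙ M) ⟨Y, hY⟩ θ else 0) ?_, ?_⟩
    · intro Y Z f hf g
      by_cases hZ : IsNontrivialPOrbit G p Z
      · have hY : IsNontrivialPOrbit G p Y :=
          ⟨isPGroup_of_mem_minSieve hf, ne_bot_of_hom g hZ.2⟩
        rw [dif_pos hY, dif_pos hZ]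
        exact map_evalAt θ (X := ⟨Z, hZ⟩) (Y := ⟨Y, hY⟩) (ObjectProperty.homMk g)
      · exact (hsub Z _ (Sieve.downward_closed _ hf g) hZ).elim _ _
    · refine constZ_hom_ext fun X => ?_
      rw [evalAt_restrictHom, freeSieveHomMk_gen, dif_pos X.property]

lemma evalAt_sylowOrbit_injective (hp : p ∣ Nat.card G) (P : Sylow p G)
    (F : (POrbitCat G p)ᵒᵖ ⥤ AddCommGrpCat.{u + 1}) :
    Function.Injective (evalAt (F := F) (sylowOrbit hp P)) := by
  intro φ ψ h
  refine constZ_hom_ext fun X => ?_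
  obtain ⟨g⟩ := exists_hom_sylow_of_mem_minSieve P
    (toTop_mem_minSieve p X.obj X.property.1)
  let g' : X ⟶ sylowOrbit hp P := ObjectProperty.homMk g
  rw [← map_evalAt φ g', ← map_evalAt ψ g', h]

end FreeSieve

/-! ### The presheaf `Pic` -/

section Pic

variable (k : Type u) [Field k] {G : Type u} [Group G] [Finite G]

lemma picPresheaf_subsingleton (X : OrbitCat G) (hX : X.subgroup = ⊥) :
    Subsingleton ((picPresheaf G k).obj (op X)) := by
  have : Subsingleton X.subgroup := hX ▸ inferInstanceAs (Subsingleton (⊥ : Subgroup G))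
  exact Tk.subsingleton_of_subsingleton k X.subgroup

lemma tkMap_toTop_resSubgroup (X : OrbitCat G) (x : Tk k G) :
    OrbitCat.tkMap k X.toTop (Tk.resSubgroup k (⊤ : Subgroup G) x) =
      Tk.resSubgroup k X.subgroup x := by
  rw [X.represents_toTop.tkMap_eq k]
  refine (DFunLike.congr_fun (Tk.res_comp _ _ _ _) x).trans ?_
  have h : (⊤ : Subgroup G).subtype.comp X.represents_toTop.conjHom = X.subgroup.subtype := by
    ext a
    change (1 : G)⁻¹ * a * 1 = a
    simp
  unfold Tk.resSubgroup
  congr 2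

lemma Tk.resSubgroup_top_bijective :
    Function.Bijective (Tk.resSubgroup k (⊤ : Subgroup G)) := by
  let i : G →* (⊤ : Subgroup G) := Subgroup.topEquiv.symm.toMonoidHom
  have hi : Function.Injective i := Subgroup.topEquiv.symm.injective
  refine Function.bijective_iff_has_inverse.2 ⟨Tk.res k i hi, fun x => ?_, fun x => ?_⟩
  · exact (DFunLike.congr_fun (Tk.res_comp _ _ i hi) x).trans
      (DFunLike.congr_fun (Tk.res_id (k := k) (G := G)) x)
  · exact (DFunLike.congr_fun (Tk.res_comp i hi _ _) x).trans
      (DFunLike.congr_fun (Tk.res_id (k := k) (G := (⊤ : Subgroup G))) x)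

lemma exists_evalAt_eq_resSubgroup (x : Tk k G) :
    ∃ ψ : constZ (OrbitCat G) ⟶ picPresheaf G k,
      ∀ X : OrbitCat G, evalAt X ψ = Additive.ofMul (Tk.resSubgroup k X.subgroup x) := by
  obtain ⟨ψ, hψ⟩ := (evalAt_top_bijective (picPresheaf G k)).2
    (Additive.ofMul (Tk.resSubgroup k (⊤ : Subgroup G) x))
  refine ⟨ψ, fun X => ?_⟩
  rw [← map_evalAt ψ X.toTop, hψ]
  exact congrArg Additive.ofMul (tkMap_toTop_resSubgroup k X x)

lemma exists_eq_resSubgroup (ψ : constZ (OrbitCat G) ⟶ picPresheaf G k) :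
    ∃ x : Tk k G,
      ∀ X : OrbitCat G, evalAt X ψ = Additive.ofMul (Tk.resSubgroup k X.subgroup x) := by
  obtain ⟨x, hx⟩ := (Tk.resSubgroup_top_bijective (G := G) k).2
    (Additive.toMul (evalAt (OrbitCat.top G) ψ))
  refine ⟨x, fun X => ?_⟩
  rw [← map_evalAt ψ X.toTop]
  refine Eq.trans ?_ (congrArg Additive.ofMul (tkMap_toTop_resSubgroup k X x))
  rw [hx]
  rfl

end Pic

/-- Two injective homomorphisms with the same range have isomorphic sources. -/
lemma exists_addEquiv_of_range_eq {A B C : Type*} [AddGroup A] [AddGroup B] [AddGroup C]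
    (f : A →+ C) (g : B →+ C) (hf : Function.Injective f) (hg : Function.Injective g)
    (h : f.range = g.range) : ∃ e : A ≃+ B, ∀ a, g (e a) = f a := by
  refine ⟨(AddMonoidHom.ofInjective hf).trans ((AddEquiv.addSubgroupCongr h).trans
    (AddMonoidHom.ofInjective hg).symm), fun a => ?_⟩
  exact AddMonoidHom.apply_ofInjective_symm hg _

end Endotrivial

theorem proposition5p1p1 {k : Type u} [Field k] {G : Type u} [Group G] [Finite G]
    (p : ℕ) [Fact p.Prime] [CharP k p] (hp : p ∣ Nat.card G) (P : Sylow p G) :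
    (∃ e : Additive (Tk.relKer k (P : Subgroup G)) ≃+ (quotPresheaf G p ⟶ picPresheaf G k),
      ∀ x : Tk.relKer k (P : Subgroup G),
        evalAt (OrbitCat.top G) (quotMap G p ≫ e (Additive.ofMul x)) =
          Additive.ofMul (Tk.resSubgroup k (⊤ : Subgroup G) x)) ∧
    ∃ r : (freeSieve (minSieve p (OrbitCat.top G)) ⟶ picPresheaf G k) ≃+
        (constZ (POrbitCat G p) ⟶ (POrbitCat.incl G p).op ⋙ picPresheaf G k),
      (∀ φ, r φ = restrictHom p (picPresheaf G k) φ) ∧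
      Function.Injective (evalAt (F := (POrbitCat.incl G p).op ⋙ picPresheaf G k) (sylowOrbit hp P)) ∧
      ∃ e' : Additive (Tk.image k (P : Subgroup G)) ≃+
          ((connecting p (picPresheaf G k)).comp r.symm.toAddMonoidHom).ker,
        ∀ y : Tk.image k (P : Subgroup G),
          evalAt (sylowOrbit hp P) (e' (Additive.ofMul y)).val = Additive.ofMul (y : Tk k P) := by
  have hePi : Epi (quotMap G p) := inferInstanceAs (Epi (Limits.cokernel.π _))
  have hinj := evalAt_sylowOrbit_injective hp P ((POrbitCat.incl G p).op ⋙ picPresheaf G k)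
  let PO : OrbitCat G := ⟨P⟩
  have hPO : minSieve p (OrbitCat.top G) PO.toTop := toTop_mem_minSieve p PO P.isPGroup'
  refine ⟨?_, AddEquiv.ofBijective _ (restrictHom_bijective (picPresheaf_subsingleton k)),
    fun _ => rfl, hinj, ?_⟩
  · let f : Additive (Tk.relKer k (P : Subgroup G)) →+
        Additive (Tk k (⊤ : Subgroup G)) :=
      MonoidHom.toAdditive ((Tk.resSubgroup k (⊤ : Subgroup G)).comp (Subgroup.subtype _))
    let g : (quotPresheaf G p ⟶ picPresheaf G k) →+
        (picPresheaf G k).obj (op (OrbitCat.top G)) :=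
      (evalAt (OrbitCat.top G)).comp (Preadditive.leftComp _ (quotMap G p))
    obtain ⟨e, he⟩ := exists_addEquiv_of_range_eq (C := (picPresheaf G k).obj (op (OrbitCat.top G))) f g
      ((Tk.resSubgroup_top_bijective k).1.comp Subtype.val_injective)
      ((evalAt_top_bijective _).1.comp fun _ _ h => (cancel_epi (quotMap G p)).1 h) (by
        ext z
        constructor
        · rintro ⟨x, rfl⟩
          obtain ⟨ψ, hψ⟩ := exists_evalAt_eq_resSubgroup k (x.toMul : Tk k G)
          -- The restriction to a `p`-subgroup factors, up to conjugation, through the one to `P`.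
          obtain ⟨χ, hχ⟩ := (exists_quotMap_comp_eq_iff p ψ).2 fun X hX => by
            obtain ⟨h⟩ := exists_hom_sylow_of_mem_minSieve P hX
            rw [← map_evalAt ψ h, hψ]
            refine (congrArg ((picPresheaf G k).map h.op).hom
              (congrArg Additive.ofMul x.toMul.2)).trans ?_
            exact map_zero ((picPresheaf G k).map h.op).hom
          exact ⟨χ, (congrArg (evalAt (OrbitCat.top G)) hχ).trans (hψ _)⟩
        · rintro ⟨χ, rfl⟩
          obtain ⟨x, hx⟩ := exists_eq_resSubgroup k (quotMap G p ≫ χ)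
          refine ⟨Additive.ofMul ⟨x, ?_⟩, (hx _).symm⟩
          exact congrArg Additive.toMul
            ((hx PO).symm.trans ((exists_quotMap_comp_eq_iff p _).1 ⟨χ, rfl⟩ PO hPO)))
    exact ⟨e, fun x => he _⟩
  · set r : (freeSieve (minSieve p (OrbitCat.top G)) ⟶ picPresheaf G k) ≃+
        (constZ (POrbitCat G p) ⟶ (POrbitCat.incl G p).op ⋙ picPresheaf G k) :=
      AddEquiv.ofBijective _ (restrictHom_bijective (picPresheaf_subsingleton k))
    have hr (ψ : constZ (OrbitCat G) ⟶ picPresheaf G k) :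
        evalAt (sylowOrbit hp P) (r (freeSieveToConst (minSieve p (OrbitCat.top G)) ≫ ψ)) =
          evalAt PO ψ :=
      (evalAt_restrictHom _ _).trans (freeSieveToConst_comp_gen _ ψ _ hPO)
    let f : Additive (Tk.image k (P : Subgroup G)) →+ Additive (Tk k (P : Subgroup G)) :=
      MonoidHom.toAdditive (Subgroup.subtype _)
    let g : ((connecting p (picPresheaf G k)).comp r.symm.toAddMonoidHom).ker →+
        (picPresheaf G k).obj (op PO) :=
      (evalAt (F := (POrbitCat.incl G p).op ⋙ picPresheaf G k) (sylowOrbit hp P)).comp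
        (AddSubgroup.subtype _)
    obtain ⟨e, he⟩ := exists_addEquiv_of_range_eq (C := (picPresheaf G k).obj (op PO)) f g Subtype.val_injective
      (hinj.comp Subtype.val_injective) (by
        ext z
        constructor
        · rintro ⟨⟨y, x, rfl⟩, rfl⟩
          obtain ⟨ψ, hψ⟩ := exists_evalAt_eq_resSubgroup k x
          refine ⟨⟨r (freeSieveToConst (minSieve p (OrbitCat.top G)) ≫ ψ), ?_⟩,
            (hr ψ).trans (hψ PO)⟩
          change connecting p _ (r.symm (r _)) = 0
          rw [r.symm_apply_apply]
          exact (connecting_eq_zero_iff p _).2 ⟨ψ, rfl⟩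
        · rintro ⟨⟨θ, hθ⟩, rfl⟩
          obtain ⟨ψ, hψ⟩ := (connecting_eq_zero_iff p _).1 hθ
          obtain ⟨x, hx⟩ := exists_eq_resSubgroup k ψ
          refine ⟨Additive.ofMul ⟨_, x, rfl⟩, ?_⟩
          refine ((hr ψ).trans (hx PO)).symm.trans ?_
          rw [hψ]
          exact congrArg (evalAt (sylowOrbit hp P)) (r.apply_symm_apply θ))
    exact ⟨e, fun y => he _⟩
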